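/- Let $G$ be a finite graph and $v$ a vertex of $G$. In the path variant of the Explorer–Director game on $G$ a token starts at $v$. In each round, if the token is on a vertex $x$, the Explorer calls a positive integer $l$ such that $G$ contains a path (without repeated vertices) of length $l$ starting at $x$, and the Director then moves the token to a vertex $y$ of his choice such that $G$ contains an $xy$-path of length $l$. The Explorer wants to maximize, and the Director to minimize, the total number of vertices visited by the token, the starting vertex included. Let $f_p(G,v)$ denote the number of visited vertices under optimal play, that is, the largest $k$ such that the Explorer can force the token to visit at least $k$ vertices whatever the Director does. For $n\ge 10$ let $CF_n$ (the cuttlefish graph) be the graph obtained from the cycle with vertices $u_1,\dots,u_n$ and edges $u_iu_{i+1}$ (indices modulo $n$) by appending two disjoint paths of length $m=\lfloor n/2\rfloor-1$ at $u_1$ and $u_2$: it has $2m$ further vertices $v_1,\dots,v_m,w_1,\dots,w_m$ and further edges $u_1v_1$, $u_2w_1$ and $v_iv_{i+1}$, $w_iw_{i+1}$ for $1\le i\le m-1$. **Theorem.** For every $n\ge 10$ and every starting vertex $v\in V(CF_n)$, $$f_p(CF_n,v)=3\left\lfloor\frac n2\right\rfloor\ \text{ if $n$ is odd},\qquad f_p(CF_n,v)=\frac{3n}{2}-1\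 \text{ if $n$ is even}.$$ -/

import Mathlib

/-- There is a path (a walk without repeated vertices) of length `l` from `x` to `y` in `G`. -/
def HasPathOfLength {V : Type*} (G : SimpleGraph V) (x y : V) (l : ℕ) : Prop :=
  ∃ p : G.Walk x y, p.IsPath ∧ p.length = l

/-- The call `l` is valid for the Explorer when the token is on `x`: `l` is positive and some path
of length `l` starts at `x`. -/
def IsValidCall {V : Type*} (G : SimpleGraph V) (x : V) (l : ℕ) : Prop :=
  0 < l ∧ ∃ y, HasPathOfLength G x y l

/-- `ExplorerForces G k S x`: in the path variant of the Explorer-Director game on `G`, when the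
token is on `x` and `S` is the set of vertices visited so far, the Explorer can force that at least
`k` vertices get visited in total, whatever the Director does.  Either at least `k` vertices have
already been visited, or there is a valid call `l` such that, for every vertex `y` to which the
Director may answer by moving the token, the Explorer can force this from the resulting position.

Being inductive (a least fixed point), the predicate holds exactly when the goal is reached after
finitely many rounds against every play of the Director; when it fails, the Director can keep the
number of visited vertices below `k` forever. -/
inductive ExplorerForces {V : Type*} [DecidableEq V] (G : SimpleGraph V) (k : ℕ) :
    Finset V → V → Prop
  | reached (S : Finset V) (x : V) (h : k ≤ S.card) : ExplorerForces G k S x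
  | call (S : Finset V) (x : V) (l : ℕ) (hl : IsValidCall G x l)
      (h : ∀ y, HasPathOfLength G x y l → ExplorerForces G k (insert y S) y) :
      ExplorerForces G k S x

/-- `f_p(G, v)`: the number of vertices (the starting vertex `v` included) that are visited under
optimal play in the path variant of the Explorer-Director game on the finite graph `G` started
at `v`, i.e. the largest `k` such that the Explorer can force at least `k` visited vertices. -/
noncomputable def pathExplorerNumber {V : Type*} [Fintype V] [DecidableEq V] (G : SimpleGraph V)
    (v : V) : ℕ :=
  sSup {k : ℕ | ExplorerForces G k {v} v}

/-- Vertices of the cuttlefish graph: the cycle vertices `u_1, …, u_n`, and the vertices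
`v_1, …, v_m` and `w_1, …, w_m` of the two appended paths, where `m = ⌊n/2⌋ - 1`.
Indices are shifted to start at `0`: `Sum.inl i` is `u_{i+1}`, `Sum.inr (Sum.inl i)` is `v_{i+1}`
and `Sum.inr (Sum.inr i)` is `w_{i+1}`. -/
abbrev CuttlefishVertex (n : ℕ) : Type :=
  Fin n ⊕ (Fin (n / 2 - 1) ⊕ Fin (n / 2 - 1))

/-- The edges of the cuttlefish graph, each listed in at least one direction: `u_i u_{i+1}`
(indices modulo `n`), `u_1 v_1`, `u_2 w_1`, `v_i v_{i+1}` and `w_i w_{i+1}`. -/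
def cuttlefishRel (n : ℕ) : CuttlefishVertex n → CuttlefishVertex n → Prop
  | .inl i, .inl j => (j : ℕ) = ((i : ℕ) + 1) % n
  | .inl i, .inr (.inl j) => (i : ℕ) = 0 ∧ (j : ℕ) = 0
  | .inl i, .inr (.inr j) => (i : ℕ) = 1 ∧ (j : ℕ) = 0
  | .inr (.inl i), .inr (.inl j) => (j : ℕ) = (i : ℕ) + 1
  | .inr (.inr i), .inr (.inr j) => (j : ℕ) = (i : ℕ) + 1
  | _, _ => False

/-- The cuttlefish graph `CF_n`: an `n`-cycle with a path of length `⌊n/2⌋ - 1` appended at each of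
the two adjacent cycle vertices `u_1` and `u_2`. -/
def cuttlefishGraph (n : ℕ) : SimpleGraph (CuttlefishVertex n) :=
  SimpleGraph.fromRel (cuttlefishRel n)

/-! The value of the game is governed by closed sets: a set is closed if the Director can answer
every valid call from one of its vertices inside the set. In a closed set containing the start, the
token never leaves. Conversely, the positions of the visited set from which the Explorer cannot
force a new vertex form a closed set. So if all nonempty closed sets have at least `k` vertices and
the start lies in one with exactly `k`, the value is `k` (`pathExplorerNumber_eq`). Here `k = n + (n
/ 2 - 1)`.

Below, cycle vertices are numbered from 0 as in the code, so the arms leave from 0 and 1. Which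
vertices a call can reach is read off from the possible path lengths between each two vertices (the
`path_..._iff` lemmas), up to the reflection exchanging the arms.

Upper bound: both arms with the cycle vertices 0, …, ⌈n/2⌉ form a closed set
(`isDirectorClosed_cuttlefishHalf`), which together with its mirror image covers the graph.

Lower bound: long calls drive the token to the ends of both arms. From an end, short calls have a
unique answer, so a nonempty closed set contains both arms and 0, 1. Longer calls from the two ends
force a vertex of each pair `{i, n - i}` and of each pair `{i, n + 2 - i}`. Either family of pairs,
with 0 and 1, falls one vertex short of the ⌈n/2⌉ + 1 needed on the cycle; playing the families
against each other, plus one call of length 1, supplies the missing vertex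
(`IsDirectorClosed.le_card`). -/

/-! ### Closed sets and the value of the game -/

section Game

variable {V : Type*}

/-- A set of vertices in which the Director can keep the token forever. -/
def IsDirectorClosed (G : SimpleGraph V) (C : Finset V) : Prop :=
  ∀ x ∈ C, ∀ l, IsValidCall G x l → ∃ y ∈ C, HasPathOfLength G x y l

theorem HasPathOfLength.symm {G : SimpleGraph V} {x y : V} {l : ℕ}
    (h : HasPathOfLength G x y l) : HasPathOfLength G y x l := by
  obtain ⟨p, hp, hl⟩ := h
  exact ⟨p.reverse, hp.reverse, by simpa using hl⟩

theorem HasPathOfLength.map {W : Type*} {G : SimpleGraph V} {H : SimpleGraph W} {x y : V} {l : ℕ}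
    (h : HasPathOfLength G x y l) (f : G →g H) (hf : Function.Injective f) :
    HasPathOfLength H (f x) (f y) l := by
  obtain ⟨p, hp, hl⟩ := h
  exact ⟨p.map f, hp.map hf, by simpa using hl⟩

/-- A sequence of distinct, consecutively adjacent vertices gives paths between its terms. -/
theorem hasPathOfLength_of_sequence {G : SimpleGraph V} {N : ℕ} (f : ℕ → V)
    (hadj : ∀ t < N, G.Adj (f t) (f (t + 1)))
    (hinj : ∀ s t, s < t → t ≤ N → f s ≠ f t) (a l : ℕ) (h : a + l ≤ N) :
    HasPathOfLength G (f a) (f (a + l)) l := by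
  suffices H : ∃ p : G.Walk (f a) (f (a + l)), p.IsPath ∧ p.length = l ∧
      ∀ z ∈ p.support, ∃ t ≤ a + l, z = f t by
    obtain ⟨p, h1, h2, -⟩ := H
    exact ⟨p, h1, h2⟩
  induction l with
  | zero => exact ⟨.nil, by simp, by simp, fun z hz => ⟨a, by simp, by simpa using hz⟩⟩
  | succ l ih =>
    obtain ⟨p, h1, h2, h3⟩ := ih (by omega)
    refine ⟨p.concat (hadj (a + l) (by omega)), ?_, by simp [h2], ?_⟩
    · refine h1.concat (fun hmem => ?_) _
      obtain ⟨t, ht, he⟩ := h3 _ hmem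
      exact hinj t (a + l + 1) (by omega) (by omega) he.symm
    · intro z hz
      rw [SimpleGraph.Walk.support_concat] at hz
      simp only [List.mem_append, List.mem_singleton] at hz
      rcases hz with hz | hz
      · obtain ⟨t, ht, he⟩ := h3 z hz
        exact ⟨t, by omega, he⟩
      · exact ⟨a + l + 1, by omega, hz⟩

/-- The vertices of a path form a sequence of distinct, consecutively adjacent vertices. -/
theorem HasPathOfLength.exists_sequence {G : SimpleGraph V} {x y : V} {l : ℕ}
    (h : HasPathOfLength G x y l) : ∃ f : ℕ → V, f 0 = x ∧ f l = y ∧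
      (∀ t < l, G.Adj (f t) (f (t + 1))) ∧ ∀ s t, s < t → t ≤ l → f s ≠ f t := by
  obtain ⟨p, hp, rfl⟩ := h
  refine ⟨p.getVert, by simp, by simp, fun t ht => p.adj_getVert_succ ht, ?_⟩
  intro s t hst ht he
  have := hp.getVert_injOn (show s ∈ {i | i ≤ p.length} from by simp; omega)
    (show t ∈ {i | i ≤ p.length} from ht) he
  omega

/-- Graph automorphisms map closed sets to closed sets. -/
theorem IsDirectorClosed.map {G : SimpleGraph V} {C : Finset V} (hC : IsDirectorClosed G C)
    (f : G ≃g G) : IsDirectorClosed G (C.map f.toEquiv.toEmbedding) := by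
  intro x hx l hl
  obtain ⟨x, hx', rfl⟩ := Finset.mem_map.1 hx
  obtain ⟨hl, z, hz⟩ := hl
  obtain ⟨y, hy, hp⟩ := hC x hx' l ⟨hl, f.symm z, by
    simpa using hz.map f.symm.toHom f.symm.injective⟩
  exact ⟨f y, Finset.mem_map.2 ⟨y, hy, rfl⟩, hp.map f.toHom f.injective⟩

variable [DecidableEq V]

/-- The Director keeps answering inside `C`, so the visited set remains a subset of `C`. -/
theorem ExplorerForces.le_card {G : SimpleGraph V} {k : ℕ} {S : Finset V} {x : V}
    (h : ExplorerForces G k S x) {C : Finset V} (hC : IsDirectorClosed G C) (hS : S ⊆ C)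
    (hx : x ∈ C) : k ≤ C.card := by
  induction h with
  | reached S x h => exact h.trans (Finset.card_le_card hS)
  | call S x l hl h ih =>
    obtain ⟨y, hy, hp⟩ := hC x hx l hl
    exact ih y hp (Finset.insert_subset hy hS) hy

/-- While fewer than `k` vertices are visited, the losing positions inside `S` would form a closed
set with fewer than `k` elements; such a set must be empty. The induction is on the number of
vertices still missing. -/
theorem explorerForces_of_forall_closed {G : SimpleGraph V} {k : ℕ}
    (hk : ∀ C : Finset V, C.Nonempty → IsDirectorClosed G C → k ≤ C.card)
    (S : Finset V) (x : V) (hx : x ∈ S) : ExplorerForces G k S x := by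
  classical
  induction hd : k - S.card using Nat.strong_induction_on generalizing S x with
  | _ d ih =>
    by_cases hS : k ≤ S.card
    · exact .reached S x hS
    by_contra hcon
    have hclosed : IsDirectorClosed G {y ∈ S | ¬ ExplorerForces G k S y} := by
      intro y hy l hl
      rw [Finset.mem_filter] at hy
      by_contra! hno
      -- If no answer to `l` is losing inside `S`, then calling `l` wins: each answer is either an
      -- old winning position or a new vertex, where the induction hypothesis applies.
      refine hy.2 (.call S y l hl fun z hz => ?_)
      by_cases hzS : z ∈ S
      · rw [Finset.insert_eq_of_mem hzS]
        by_contra hzf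
        exact hno z (Finset.mem_filter.2 ⟨hzS, hzf⟩) hz
      · have := Finset.card_insert_of_notMem hzS
        exact ih (k - (insert z S).card) (by omega) _ z (Finset.mem_insert_self _ _) rfl
    have h1 := hk _ ⟨x, Finset.mem_filter.2 ⟨hx, hcon⟩⟩ hclosed
    have h2 := Finset.card_filter_le S (fun y => ¬ ExplorerForces G k S y)
    omega

theorem pathExplorerNumber_eq [Fintype V] {G : SimpleGraph V} {k : ℕ} {v : V}
    (hk : ∀ C : Finset V, C.Nonempty → IsDirectorClosed G C → k ≤ C.card)
    {C : Finset V} (hv : v ∈ C) (hC : IsDirectorClosed G C) (hcard : C.card ≤ k) :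
    pathExplorerNumber G v = k := by
  refine IsGreatest.csSup_eq ⟨explorerForces_of_forall_closed hk _ _ (by simp), ?_⟩
  intro j hj
  exact (hj.le_card hC (by simpa using hv) hv).trans hcard

end Game

/-! ### Adjacency in the cuttlefish graph -/

section Neighbours

variable {n : ℕ}

theorem adj_cycle_iff (hn : 3 ≤ n) (a : Fin n) (z : CuttlefishVertex n) :
    (cuttlefishGraph n).Adj (.inl a) z ↔
      (∃ b : Fin n, z = .inl b ∧ ((b : ℕ) = a + 1 ∨ (a : ℕ) = b + 1 ∨
        ((a : ℕ) + 1 = n ∧ (b : ℕ) = 0) ∨ ((b : ℕ) + 1 = n ∧ (a : ℕ) = 0))) ∨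
      (∃ c, z = .inr (.inl c) ∧ (a : ℕ) = 0 ∧ (c : ℕ) = 0) ∨
      (∃ c, z = .inr (.inr c) ∧ (a : ℕ) = 1 ∧ (c : ℕ) = 0) := by
  have key : ∀ p q : Fin n, (q : ℕ) = ((p : ℕ) + 1) % n ↔
      ((q : ℕ) = p + 1 ∨ ((p : ℕ) + 1 = n ∧ (q : ℕ) = 0)) := by
    intro p q
    have := p.2
    have := q.2
    rcases Nat.lt_or_ge ((p : ℕ) + 1) n with h | h
    · rw [Nat.mod_eq_of_lt h]; omega
    · have h' : (p : ℕ) + 1 = n := by omega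
      rw [h', Nat.mod_self]; omega
  rcases z with b | c | c
  · have := a.2
    have := b.2
    simp only [cuttlefishGraph, SimpleGraph.fromRel_adj, cuttlefishRel, key, Sum.inl.injEq,
      ne_eq, Fin.ext_iff, reduceCtorEq, false_and, exists_false, or_false]
    constructor
    · rintro ⟨h1, h2⟩
      exact ⟨b, rfl, by omega⟩
    · rintro ⟨b', h1, h2⟩
      omega
  · simp [cuttlefishGraph, SimpleGraph.fromRel_adj, cuttlefishRel]
  · simp [cuttlefishGraph, SimpleGraph.fromRel_adj, cuttlefishRel]

theorem adj_left_iff (a : Fin (n / 2 - 1)) (z : CuttlefishVertex n) :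
    (cuttlefishGraph n).Adj (.inr (.inl a)) z ↔
      (∃ b : Fin n, z = .inl b ∧ (b : ℕ) = 0 ∧ (a : ℕ) = 0) ∨
      (∃ c : Fin (n / 2 - 1), z = .inr (.inl c) ∧ ((c : ℕ) = a + 1 ∨ (a : ℕ) = c + 1)) := by
  rcases z with b | c | c
  · simp [cuttlefishGraph, SimpleGraph.fromRel_adj, cuttlefishRel]
  · simp [cuttlefishGraph, SimpleGraph.fromRel_adj, cuttlefishRel, Fin.ext_iff]
    constructor
    · rintro ⟨h1, h2⟩
      exact ⟨c, rfl, by omega⟩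
    · rintro ⟨b', h1, h2⟩
      omega
  · simp [cuttlefishGraph, SimpleGraph.fromRel_adj, cuttlefishRel]

theorem adj_right_iff (a : Fin (n / 2 - 1)) (z : CuttlefishVertex n) :
    (cuttlefishGraph n).Adj (.inr (.inr a)) z ↔
      (∃ b : Fin n, z = .inl b ∧ (b : ℕ) = 1 ∧ (a : ℕ) = 0) ∨
      (∃ c : Fin (n / 2 - 1), z = .inr (.inr c) ∧ ((c : ℕ) = a + 1 ∨ (a : ℕ) = c + 1)) := by
  rcases z with b | c | c
  · simp [cuttlefishGraph, SimpleGraph.fromRel_adj, cuttlefishRel]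
  · simp [cuttlefishGraph, SimpleGraph.fromRel_adj, cuttlefishRel]
  · simp [cuttlefishGraph, SimpleGraph.fromRel_adj, cuttlefishRel, Fin.ext_iff]
    constructor
    · rintro ⟨h1, h2⟩
      exact ⟨c, rfl, by omega⟩
    · rintro ⟨b', h1, h2⟩
      omega

end Neighbours

/-! ### Necessary conditions on path lengths -/

section PathLengths

variable {n : ℕ}

/-- Invariant of a path `f` from `u_i`: the position of `f t`, `f (t + 1)`. -/
theorem cycle_sequence_position (hn : 3 ≤ n) (i : Fin n) (f : ℕ → CuttlefishVertex n) (l : ℕ)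
    (h0 : f 0 = .inl i) (hadj : ∀ t < l, (cuttlefishGraph n).Adj (f t) (f (t + 1)))
    (hinj : ∀ s t, s < t → t ≤ l → f s ≠ f t) (t : ℕ) (ht : t + 1 ≤ l) :
    (∃ a b : Fin n, f t = .inl a ∧ f (t + 1) = .inl b ∧ t + 1 < n ∧
      (((b : ℕ) = a + 1 ∨ ((a : ℕ) + 1 = n ∧ (b : ℕ) = 0)) ∧
          ((a : ℕ) = i + t ∨ (a : ℕ) + n = i + t) ∨
        ((a : ℕ) = b + 1 ∨ ((b : ℕ) + 1 = n ∧ (a : ℕ) = 0)) ∧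
          ((a : ℕ) + t = i ∨ (a : ℕ) + t = i + n))) ∨
    (∃ c : Fin (n / 2 - 1), f (t + 1) = .inr (.inl c) ∧
      ((∃ a : Fin n, f t = .inl a ∧ (c : ℕ) = 0) ∨
        ∃ b : Fin (n / 2 - 1), f t = .inr (.inl b) ∧ (c : ℕ) = b + 1) ∧
      (t = c + i ∨ ((i : ℕ) ≠ 0 ∧ t + i = c + n))) ∨
    (∃ c : Fin (n / 2 - 1), f (t + 1) = .inr (.inr c) ∧
      ((∃ a : Fin n, f t = .inl a ∧ (c : ℕ) = 0) ∨
        ∃ b : Fin (n / 2 - 1), f t = .inr (.inr b) ∧ (c : ℕ) = b + 1) ∧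
      ((1 ≤ (i : ℕ) ∧ t + 1 = c + i) ∨ (2 ≤ (i : ℕ) ∧ t + i = c + 1 + n) ∨
        ((i : ℕ) = 0 ∧ (t = c + 1 ∨ t + 1 = c + n)))) := by
  have hi := i.2
  induction t with
  | zero =>
    have h1 := hadj 0 (by omega)
    rw [h0, adj_cycle_iff hn] at h1
    rcases h1 with ⟨b, hb, h⟩ | ⟨c, hc, h⟩ | ⟨c, hc, h⟩
    · have := b.2
      exact .inl ⟨i, b, h0, hb, by omega, by omega⟩
    · exact .inr (.inl ⟨c, hc, .inl ⟨i, h0, h.2⟩, by omega⟩)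
    · exact .inr (.inr ⟨c, hc, .inl ⟨i, h0, h.2⟩, by omega⟩)
  | succ t ih =>
    have h1 := hadj (t + 1) (by omega)
    have hne : f t ≠ f (t + 2) := hinj _ _ (by omega) (by omega)
    -- The path may not close up at its start; this yields the bound `t + 1 < n` while it stays on
    -- the cycle.
    have hne0 : f 0 ≠ f (t + 2) := hinj _ _ (by omega) (by omega)
    rcases ih (by omega) with ⟨a, b, ha, hb, hlt, h⟩ | ⟨c, hc, hp, h⟩ | ⟨c, hc, hp, h⟩
    · have := a.2
      have := b.2
      rw [hb, adj_cycle_iff hn] at h1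
      rcases h1 with ⟨b', hb', h'⟩ | ⟨c, hc, h'⟩ | ⟨c, hc, h'⟩
      · have := b'.2
        rw [ha, hb'] at hne
        rw [h0, hb'] at hne0
        simp only [ne_eq, Sum.inl.injEq, Fin.ext_iff] at hne hne0
        exact .inl ⟨b, b', hb, hb', by omega, by omega⟩
      · exact .inr (.inl ⟨c, hc, .inl ⟨b, hb, h'.2⟩, by omega⟩)
      · exact .inr (.inr ⟨c, hc, .inl ⟨b, hb, h'.2⟩, by omega⟩)
    · rw [hc, adj_left_iff] at h1
      rcases h1 with ⟨b, hb, h'⟩ | ⟨c', hc', h'⟩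
      -- A path that has entered an arm cannot return to the cycle: the only exit is the vertex it
      -- came from.
      · rcases hp with ⟨a, ha, ha'⟩ | ⟨a, ha, ha'⟩
        · have h2 := hadj t (by omega)
          rw [hc, ha, adj_cycle_iff hn] at h2
          simp only [reduceCtorEq, false_and, exists_false, false_or, or_false, Sum.inr.injEq,
            Sum.inl.injEq] at h2
          obtain ⟨c', -, h3, -⟩ := h2
          exact absurd (ha.trans ((congrArg _ (Fin.ext (by omega))).trans hb.symm)) hne
        · omega
      · refine .inr (.inl ⟨c', hc', .inr ⟨c, hc, ?_⟩, ?_⟩)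
        all_goals
          rcases hp with ⟨a, ha, ha'⟩ | ⟨a, ha, ha'⟩
          · omega
          · rw [ha, hc'] at hne
            simp only [ne_eq, Sum.inr.injEq, Sum.inl.injEq, Fin.ext_iff] at hne
            omega
    · rw [hc, adj_right_iff] at h1
      rcases h1 with ⟨b, hb, h'⟩ | ⟨c', hc', h'⟩
      · rcases hp with ⟨a, ha, ha'⟩ | ⟨a, ha, ha'⟩
        · have h2 := hadj t (by omega)
          rw [hc, ha, adj_cycle_iff hn] at h2
          simp only [reduceCtorEq, false_and, exists_false, false_or, Sum.inr.injEq] at h2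
          obtain ⟨c', -, h3, -⟩ := h2
          exact absurd (ha.trans ((congrArg _ (Fin.ext (by omega))).trans hb.symm)) hne
        · omega
      · refine .inr (.inr ⟨c', hc', .inr ⟨c, hc, ?_⟩, ?_⟩)
        all_goals
          rcases hp with ⟨a, ha, ha'⟩ | ⟨a, ha, ha'⟩
          · omega
          · rw [ha, hc'] at hne
            simp only [ne_eq, Sum.inr.injEq, Fin.ext_iff] at hne
            omega

/-- Invariant of a path `f` from `v_j`: the position of `f t`, `f (t + 1)`. -/
theorem left_sequence_position (hn : 3 ≤ n) (j : Fin (n / 2 - 1)) (f : ℕ → CuttlefishVertex n)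
    (l : ℕ) (h0 : f 0 = .inr (.inl j))
    (hadj : ∀ t < l, (cuttlefishGraph n).Adj (f t) (f (t + 1)))
    (hinj : ∀ s t, s < t → t ≤ l → f s ≠ f t) (t : ℕ) (ht : t + 1 ≤ l) :
    (∃ a b : Fin (n / 2 - 1), f t = .inr (.inl a) ∧ f (t + 1) = .inr (.inl b) ∧
      ((b : ℕ) = a + 1 ∧ (a : ℕ) = j + t ∨ (a : ℕ) = b + 1 ∧ (a : ℕ) + t = j)) ∨
    (∃ (a : Fin (n / 2 - 1)) (b : Fin n), f t = .inr (.inl a) ∧ f (t + 1) = .inl b ∧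
      (a : ℕ) = 0 ∧ (b : ℕ) = 0 ∧ t = j) ∨
    (∃ a b : Fin n, f t = .inl a ∧ f (t + 1) = .inl b ∧ (b : ℕ) ≠ 0 ∧
      (∃ z : Fin n, (z : ℕ) = 0 ∧ f (j + 1) = .inl z) ∧ j + 1 < t + 1 ∧
      ((b : ℕ) = a + 1 ∧ t = j + b ∨
        ((a : ℕ) = b + 1 ∨ ((b : ℕ) + 1 = n ∧ (a : ℕ) = 0)) ∧ t + b = j + n)) ∨
    (∃ c : Fin (n / 2 - 1), f (t + 1) = .inr (.inr c) ∧
      ((∃ a : Fin n, f t = .inl a ∧ (c : ℕ) = 0) ∨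
        ∃ b : Fin (n / 2 - 1), f t = .inr (.inr b) ∧ (c : ℕ) = b + 1) ∧
      (t = j + c + 2 ∨ t = j + n + c)) := by
  have hj := j.2
  induction t with
  | zero =>
    have h1 := hadj 0 (by omega)
    rw [h0, adj_left_iff] at h1
    rcases h1 with ⟨b, hb, h⟩ | ⟨c, hc, h⟩
    · exact .inr (.inl ⟨j, b, h0, hb, by omega, by omega, by omega⟩)
    · exact .inl ⟨j, c, h0, hc, by omega⟩
  | succ t ih =>
    have h1 := hadj (t + 1) (by omega)
    have hne : f t ≠ f (t + 2) := hinj _ _ (by omega) (by omega)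
    rcases ih (by omega) with ⟨a, b, ha, hb, h⟩ | ⟨a, b, ha, hb, h⟩ |
      ⟨a, b, ha, hb, hb0, ⟨z, hz, hfz⟩, hjt, h⟩ | ⟨c, hc, hp, h⟩
    · rw [hb, adj_left_iff] at h1
      rcases h1 with ⟨b', hb', h'⟩ | ⟨c, hc, h'⟩
      · exact .inr (.inl ⟨b, b', hb, hb', by omega, by omega, by omega⟩)
      · rw [ha, hc] at hne
        simp only [ne_eq, Sum.inr.injEq, Sum.inl.injEq, Fin.ext_iff] at hne
        exact .inl ⟨b, c, hb, hc, by omega⟩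
    · rw [hb, adj_cycle_iff hn] at h1
      rcases h1 with ⟨b', hb', h'⟩ | ⟨c, hc, h'⟩ | ⟨c, hc, h'⟩
      · refine .inr (.inr (.inl ⟨b, b', hb, hb', by omega, ⟨b, h.2.1, ?_⟩, by omega, by omega⟩))
        rw [← h.2.2, hb]
      · rw [ha, hc] at hne
        simp only [ne_eq, Sum.inr.injEq, Sum.inl.injEq, Fin.ext_iff] at hne
        omega
      · omega
    · have := b.2
      rw [hb, adj_cycle_iff hn] at h1
      rcases h1 with ⟨b', hb', h'⟩ | ⟨c, hc, h'⟩ | ⟨c, hc, h'⟩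
      -- Index 0 was used on leaving the arm, so the path cannot pass it again; the invariant
      -- carries `f (j + 1)` for this purpose.
      · have hz0 := hinj (j + 1) (t + 2) (by omega) (by omega)
        have := b'.2
        have := a.2
        rw [hfz, hb'] at hz0
        rw [ha, hb'] at hne
        simp only [ne_eq, Sum.inl.injEq, Fin.ext_iff] at hne hz0
        exact .inr (.inr (.inl ⟨b, b', hb, hb', by omega, ⟨z, hz, hfz⟩, by omega, by omega⟩))
      · omega
      · exact .inr (.inr (.inr ⟨c, hc, .inl ⟨b, hb, h'.2⟩, by omega⟩))
    · rw [hc, adj_right_iff] at h1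
      rcases h1 with ⟨b, hb, h'⟩ | ⟨c', hc', h'⟩
      · rcases hp with ⟨a, ha, ha'⟩ | ⟨a, ha, ha'⟩
        · have h2 := hadj t (by omega)
          rw [hc, ha, adj_cycle_iff hn] at h2
          simp only [reduceCtorEq, false_and, exists_false, false_or, Sum.inr.injEq] at h2
          obtain ⟨c', -, h3, -⟩ := h2
          exact absurd (ha.trans ((congrArg _ (Fin.ext (by omega))).trans hb.symm)) hne
        · omega
      · refine .inr (.inr (.inr ⟨c', hc', .inr ⟨c, hc, ?_⟩, ?_⟩))
        all_goals
          rcases hp with ⟨a, ha, ha'⟩ | ⟨a, ha, ha'⟩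
          · omega
          · rw [ha, hc'] at hne
            simp only [ne_eq, Sum.inr.injEq, Fin.ext_iff] at hne
            omega

theorem path_cycle_cycle (hn : 3 ≤ n) {i k : Fin n} {l : ℕ}
    (h : HasPathOfLength (cuttlefishGraph n) (.inl i) (.inl k) l) :
    l < n ∧ (l + i = k ∨ l + k = i ∨ l + i = k + n ∨ l + k = i + n) := by
  obtain ⟨f, h0, h1, hadj, hinj⟩ := h.exists_sequence
  rcases l with _ | l
  · have := h0.symm.trans h1
    simp only [Sum.inl.injEq] at this
    subst this
    omega
  · have := cycle_sequence_position hn i f _ h0 hadj hinj l le_rfl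
    rw [h1] at this
    rcases this with ⟨a, b, -, hb, h⟩ | ⟨c, hc, -⟩ | ⟨c, hc, -⟩
    · simp only [Sum.inl.injEq] at hb
      subst hb
      omega
    · simp at hc
    · simp at hc

theorem path_cycle_left (hn : 3 ≤ n) {i : Fin n} {c : Fin (n / 2 - 1)} {l : ℕ}
    (h : HasPathOfLength (cuttlefishGraph n) (.inl i) (.inr (.inl c)) l) :
    l = c + 1 + i ∨ ((i : ℕ) ≠ 0 ∧ l + i = c + 1 + n) := by
  obtain ⟨f, h0, h1, hadj, hinj⟩ := h.exists_sequence
  rcases l with _ | l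
  · simp [h0] at h1
  · have := cycle_sequence_position hn i f _ h0 hadj hinj l le_rfl
    rw [h1] at this
    rcases this with ⟨a, b, -, hb, h⟩ | ⟨c, hc, -, h⟩ | ⟨c, hc, -⟩
    · simp at hb
    · simp only [Sum.inl.injEq, Sum.inr.injEq] at hc
      subst hc
      omega
    · simp at hc

theorem path_cycle_right (hn : 3 ≤ n) {i : Fin n} {c : Fin (n / 2 - 1)} {l : ℕ}
    (h : HasPathOfLength (cuttlefishGraph n) (.inl i) (.inr (.inr c)) l) :
    (1 ≤ (i : ℕ) ∧ l = c + i) ∨ (2 ≤ (i : ℕ) ∧ l + i = c + 2 + n) ∨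
        ((i : ℕ) = 0 ∧ (l = c + 2 ∨ l = c + n)) := by
  obtain ⟨f, h0, h1, hadj, hinj⟩ := h.exists_sequence
  rcases l with _ | l
  · simp [h0] at h1
  · have := cycle_sequence_position hn i f _ h0 hadj hinj l le_rfl
    rw [h1] at this
    rcases this with ⟨a, b, -, hb, h⟩ | ⟨c, hc, -⟩ | ⟨c, hc, -, h⟩
    · simp at hb
    · simp at hc
    · simp only [Sum.inr.injEq] at hc
      subst hc
      omega

theorem path_left_left (hn : 3 ≤ n) {j c : Fin (n / 2 - 1)} {l : ℕ}
    (h : HasPathOfLength (cuttlefishGraph n) (.inr (.inl j)) (.inr (.inl c)) l) :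
    l + j = c ∨ l + c = j := by
  obtain ⟨f, h0, h1, hadj, hinj⟩ := h.exists_sequence
  rcases l with _ | l
  · have := h0.symm.trans h1
    simp only [Sum.inl.injEq, Sum.inr.injEq] at this
    subst this
    omega
  · have := left_sequence_position hn j f _ h0 hadj hinj l le_rfl
    rw [h1] at this
    rcases this with ⟨a, b, -, hb, h⟩ | ⟨a, b, -, hb, h⟩ | ⟨a, b, -, hb, h⟩ | ⟨c, hc, -⟩
    · simp only [Sum.inl.injEq, Sum.inr.injEq] at hb
      subst hb
      omega
    · simp at hb
    · simp at hb
    · simp at hc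

theorem path_left_right (hn : 3 ≤ n) {j c : Fin (n / 2 - 1)} {l : ℕ}
    (h : HasPathOfLength (cuttlefishGraph n) (.inr (.inl j)) (.inr (.inr c)) l) :
    l = j + c + 3 ∨ l = j + c + n + 1 := by
  obtain ⟨f, h0, h1, hadj, hinj⟩ := h.exists_sequence
  rcases l with _ | l
  · simp [h0] at h1
  · have := left_sequence_position hn j f _ h0 hadj hinj l le_rfl
    rw [h1] at this
    rcases this with ⟨a, b, -, hb, h⟩ | ⟨a, b, -, hb, h⟩ | ⟨a, b, -, hb, h⟩ | ⟨c, hc, -, h⟩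
    · simp at hb
    · simp at hb
    · simp at hb
    · simp only [Sum.inr.injEq] at hc
      subst hc
      omega

end PathLengths

/-! ### The reflection exchanging the two arms -/

section Reflection

variable {n : ℕ}

/-- The reflection of the cuttlefish graph exchanging `u_i` with `u_{3-i}` and `v_i` with `w_i`. -/
def cuttlefishReflect (n : ℕ) : CuttlefishVertex n → CuttlefishVertex n
  -- The map is `i ↦ 1 - i` modulo `n`; the case `n = 1` only keeps the value below `n`.
  | .inl i => .inl ⟨if n = 1 then i else if (i : ℕ) ≤ 1 then 1 - i else n + 1 - i, by
      have := i.2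
      split_ifs <;> omega⟩
  | .inr (.inl c) => .inr (.inr c)
  | .inr (.inr c) => .inr (.inl c)

theorem cuttlefishReflect_involutive (n : ℕ) : Function.Involutive (cuttlefishReflect n) := by
  rintro (i | c | c)
  · have := i.2
    simp only [cuttlefishReflect, Sum.inl.injEq, Fin.ext_iff]
    split_ifs <;> omega
  · rfl
  · rfl

theorem cuttlefishReflect_adj (hn : 3 ≤ n) {x y : CuttlefishVertex n}
    (h : (cuttlefishGraph n).Adj x y) :
    (cuttlefishGraph n).Adj (cuttlefishReflect n x) (cuttlefishReflect n y) := by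
  rcases x with i | c | c
  · have := i.2
    simp only [cuttlefishReflect]
    rw [adj_cycle_iff hn] at h ⊢
    rcases h with ⟨b, rfl, h⟩ | ⟨c, rfl, h⟩ | ⟨c, rfl, h⟩
    · have := b.2
      refine .inl ⟨_, rfl, ?_⟩
      dsimp only
      split_ifs <;> omega
    · refine .inr (.inr ⟨c, rfl, ?_⟩)
      dsimp only
      split_ifs <;> omega
    · refine .inr (.inl ⟨c, rfl, ?_⟩)
      dsimp only
      split_ifs <;> omega
  · simp only [cuttlefishReflect]
    rw [adj_left_iff] at h
    rw [adj_right_iff]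
    rcases h with ⟨b, rfl, h⟩ | ⟨c, rfl, h⟩
    · refine .inl ⟨_, rfl, ?_⟩
      dsimp only
      split_ifs <;> omega
    · exact .inr ⟨c, rfl, h⟩
  · simp only [cuttlefishReflect]
    rw [adj_right_iff] at h
    rw [adj_left_iff]
    rcases h with ⟨b, rfl, h⟩ | ⟨c, rfl, h⟩
    · refine .inl ⟨_, rfl, ?_⟩
      dsimp only
      split_ifs <;> omega
    · exact .inr ⟨c, rfl, h⟩

/-- The reflection as a graph automorphism. -/
def cuttlefishReflectIso (hn : 3 ≤ n) : cuttlefishGraph n ≃g cuttlefishGraph n where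
  toEquiv := (cuttlefishReflect_involutive n).toPerm
  map_rel_iff' {x y} := by
    refine ⟨fun h => ?_, cuttlefishReflect_adj hn⟩
    have := cuttlefishReflect_adj hn h
    simpa [cuttlefishReflect_involutive n x, cuttlefishReflect_involutive n y] using this

theorem HasPathOfLength.reflect (hn : 3 ≤ n) {x y : CuttlefishVertex n} {l : ℕ}
    (h : HasPathOfLength (cuttlefishGraph n) x y l) :
    HasPathOfLength (cuttlefishGraph n) (cuttlefishReflect n x) (cuttlefishReflect n y) l :=
  h.map (cuttlefishReflectIso hn).toHom (cuttlefishReflectIso hn).injective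

end Reflection

/-! ### Construction of paths of all these lengths -/

section Existence

variable {n : ℕ}

theorem path_cycle_cycle_iff (hn : 3 ≤ n) {i k : Fin n} {l : ℕ} :
    HasPathOfLength (cuttlefishGraph n) (.inl i) (.inl k) l ↔
      l < n ∧ (l + i = k ∨ l + k = i ∨ l + i = k + n ∨ l + k = i + n) := by
  refine ⟨path_cycle_cycle hn, ?_⟩
  have key : ∀ i k : Fin n, l < n → (l + i = k ∨ l + i = k + n) →
      HasPathOfLength (cuttlefishGraph n) (.inl i) (.inl k) l := by
    intro i k hl h
    have hi := i.2
    have hk := k.2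
    let f : ℕ → CuttlefishVertex n := fun t =>
      .inl (if h : i + t < n then ⟨i + t, h⟩ else ⟨(i + t - n) % n, Nat.mod_lt _ (by omega)⟩)
    have hf : ∀ t < n, ∃ a : Fin n, f t = .inl a ∧ ((a : ℕ) = i + t ∨ (a : ℕ) + n = i + t) := by
      intro t ht
      refine ⟨_, rfl, ?_⟩
      split_ifs with h
      · exact .inl rfl
      · right
        change (i + t - n) % n + n = i + t
        rw [Nat.mod_eq_of_lt (by omega)]
        omega
    have := hasPathOfLength_of_sequence (G := cuttlefishGraph n) (N := n - 1) f ?_ ?_ 0 l (by omega)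
    · obtain ⟨a, ha, ha'⟩ := hf 0 (by omega)
      obtain ⟨b, hb, hb'⟩ := hf (0 + l) (by omega)
      have hai : a = i := Fin.ext (by omega)
      have hbk : b = k := Fin.ext (by omega)
      rwa [ha, hb, hai, hbk] at this
    · intro t ht
      obtain ⟨a, ha, ha'⟩ := hf t (by omega)
      obtain ⟨b, hb, hb'⟩ := hf (t + 1) (by omega)
      have := a.2
      have := b.2
      rw [ha, hb, adj_cycle_iff hn]
      exact .inl ⟨b, rfl, by omega⟩
    · intro s t hst ht
      obtain ⟨a, ha, ha'⟩ := hf s (by omega)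
      obtain ⟨b, hb, hb'⟩ := hf t (by omega)
      rw [ha, hb]
      simp only [ne_eq, Sum.inl.injEq, Fin.ext_iff]
      omega
  rintro ⟨hl, h | h | h | h⟩
  · exact key i k hl (.inl h)
  · exact (key k i hl (.inl h)).symm
  · exact key i k hl (.inr h)
  · exact (key k i hl (.inr h)).symm

/-- The path `v_m, …, v_1, u_1, u_2, …, u_n`. -/
theorem left_forward_paths (hn : 10 ≤ n) :
    ∃ f : ℕ → CuttlefishVertex n,
      (∀ c : Fin (n / 2 - 1), f (n / 2 - 2 - c) = .inr (.inl c)) ∧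
      (∀ k : Fin n, f (n / 2 - 1 + k) = .inl k) ∧
      ∀ a l, a + l ≤ n / 2 - 1 + (n - 1) →
        HasPathOfLength (cuttlefishGraph n) (f a) (f (a + l)) l := by
  -- The remainder only makes `f` total; it has no effect on the range of `t` that is used.
  let f : ℕ → CuttlefishVertex n := fun t =>
    if h : t < n / 2 - 1 then .inr (.inl ⟨n / 2 - 2 - t, by omega⟩)
    else .inl ⟨(t - (n / 2 - 1)) % n, Nat.mod_lt _ (by omega)⟩
  have hf1 : ∀ c : Fin (n / 2 - 1), f (n / 2 - 2 - c) = .inr (.inl c) := by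
    intro c
    have := c.2
    simp only [f]
    rw [dif_pos (by omega)]
    simp only [Sum.inr.injEq, Sum.inl.injEq, Fin.ext_iff]
    omega
  have hf2 : ∀ k : Fin n, f (n / 2 - 1 + k) = .inl k := by
    intro k
    simp only [f]
    rw [dif_neg (by omega)]
    simp [Nat.mod_eq_of_lt]
  have hf : ∀ t ≤ n / 2 - 1 + (n - 1),
      (∃ c : Fin (n / 2 - 1), f t = .inr (.inl c) ∧ t + c + 1 = n / 2 - 1) ∨
      ∃ k : Fin n, f t = .inl k ∧ n / 2 - 1 + k = t := by
    intro t ht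
    by_cases h : t < n / 2 - 1
    · refine .inl ⟨⟨n / 2 - 2 - t, by omega⟩, ?_, ?_⟩
      · rw [← hf1]; congr 1; dsimp only; omega
      · dsimp only; omega
    · refine .inr ⟨⟨t - (n / 2 - 1), by omega⟩, ?_, ?_⟩
      · rw [← hf2]; congr 1; dsimp only; omega
      · dsimp only; omega
  refine ⟨f, hf1, hf2, hasPathOfLength_of_sequence f ?_ ?_⟩
  · intro t ht
    rcases hf t (by omega) with ⟨c, hc, h⟩ | ⟨k, hk, h⟩ <;>
    rcases hf (t + 1) (by omega) with ⟨c', hc', h'⟩ | ⟨k', hk', h'⟩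
    · rw [hc, hc', adj_left_iff]
      exact .inr ⟨c', rfl, by omega⟩
    · rw [hc, hk', adj_left_iff]
      exact .inl ⟨k', rfl, by omega⟩
    · omega
    · rw [hk, hk', adj_cycle_iff (by omega)]
      exact .inl ⟨k', rfl, by omega⟩
  · intro s t hst ht
    rcases hf s (by omega) with ⟨c, hc, h⟩ | ⟨k, hk, h⟩ <;>
    rcases hf t (by omega) with ⟨c', hc', h'⟩ | ⟨k', hk', h'⟩
    · rw [hc, hc']
      simp only [ne_eq, Sum.inr.injEq, Sum.inl.injEq, Fin.ext_iff]
      omega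
    · rw [hc, hk']; simp
    · rw [hk, hc']; simp
    · rw [hk, hk']
      simp only [ne_eq, Sum.inl.injEq, Fin.ext_iff]
      omega

/-- The path `v_m, …, v_1, u_1, u_n, …, u_2, w_1, …, w_m`. -/
theorem left_backward_paths (hn : 10 ≤ n) :
    ∃ f : ℕ → CuttlefishVertex n,
      (∀ c : Fin (n / 2 - 1), f (n / 2 - 2 - c) = .inr (.inl c)) ∧
      (∀ k : Fin n, (k : ℕ) ≠ 0 → f (n / 2 - 1 + (n - k)) = .inl k) ∧
      (∀ c : Fin (n / 2 - 1), f (n / 2 - 1 + n + c) = .inr (.inr c)) ∧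
      ∀ a l, a + l ≤ n / 2 - 1 + n + (n / 2 - 2) →
        HasPathOfLength (cuttlefishGraph n) (f a) (f (a + l)) l := by
  let f : ℕ → CuttlefishVertex n := fun t =>
    if h : t < n / 2 - 1 then .inr (.inl ⟨n / 2 - 2 - t, by omega⟩)
    else if h : t < n / 2 - 1 + n then .inl ⟨(n - (t - (n / 2 - 1))) % n, Nat.mod_lt _ (by omega)⟩
    else .inr (.inr ⟨(t - (n / 2 - 1 + n)) % (n / 2 - 1), Nat.mod_lt _ (by omega)⟩)
  have hf1 : ∀ c : Fin (n / 2 - 1), f (n / 2 - 2 - c) = .inr (.inl c) := by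
    intro c
    have := c.2
    simp only [f]
    rw [dif_pos (by omega)]
    simp only [Sum.inr.injEq, Sum.inl.injEq, Fin.ext_iff]
    omega
  have hf0 : f (n / 2 - 1) = .inl ⟨0, by omega⟩ := by
    simp only [f]
    rw [dif_neg (by omega), dif_pos (by omega)]
    simp
  have hf2 : ∀ k : Fin n, (k : ℕ) ≠ 0 → f (n / 2 - 1 + (n - k)) = .inl k := by
    intro k hk
    have := k.2
    simp only [f]
    rw [dif_neg (by omega), dif_pos (by omega)]
    simp only [Sum.inl.injEq, Fin.ext_iff]
    rw [Nat.mod_eq_of_lt (by omega)]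
    omega
  have hf3 : ∀ c : Fin (n / 2 - 1), f (n / 2 - 1 + n + c) = .inr (.inr c) := by
    intro c
    simp only [f]
    rw [dif_neg (by omega), dif_neg (by omega)]
    simp [Nat.mod_eq_of_lt]
  have hf : ∀ t ≤ n / 2 - 1 + n + (n / 2 - 2),
      (∃ c : Fin (n / 2 - 1), f t = .inr (.inl c) ∧ t + c + 1 = n / 2 - 1) ∨
      (∃ k : Fin n, f t = .inl k ∧ ((k : ℕ) = 0 ∧ t = n / 2 - 1 ∨
        (k : ℕ) ≠ 0 ∧ n / 2 - 1 + n = t + k)) ∨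
      ∃ c : Fin (n / 2 - 1), f t = .inr (.inr c) ∧ t = n / 2 - 1 + n + c := by
    intro t ht
    rcases lt_trichotomy t (n / 2 - 1) with h | h | h
    · refine .inl ⟨⟨n / 2 - 2 - t, by omega⟩, ?_, ?_⟩
      · rw [← hf1]; congr 1; dsimp only; omega
      · dsimp only; omega
    · exact .inr (.inl ⟨_, by rw [h]; exact hf0, .inl ⟨rfl, h⟩⟩)
    · by_cases h' : t < n / 2 - 1 + n
      · refine .inr (.inl ⟨⟨n - (t - (n / 2 - 1)), by omega⟩, ?_, ?_⟩)
        · rw [← hf2 _ (by dsimp only; omega)]; congr 1; dsimp only; omega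
        · dsimp only; omega
      · refine .inr (.inr ⟨⟨t - (n / 2 - 1 + n), by omega⟩, ?_, ?_⟩)
        · rw [← hf3]; congr 1; dsimp only; omega
        · dsimp only; omega
  refine ⟨f, hf1, hf2, hf3, hasPathOfLength_of_sequence f ?_ ?_⟩
  · intro t ht
    rcases hf t (by omega) with ⟨c, hc, h⟩ | ⟨k, hk, h⟩ | ⟨c, hc, h⟩ <;>
    rcases hf (t + 1) (by omega) with ⟨c', hc', h'⟩ | ⟨k', hk', h'⟩ | ⟨c', hc', h'⟩ <;>
    try omega
    · rw [hc, hc', adj_left_iff]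
      exact .inr ⟨c', rfl, by omega⟩
    · rw [hc, hk', adj_left_iff]
      exact .inl ⟨k', rfl, by omega⟩
    · rw [hk, hk', adj_cycle_iff (by omega)]
      exact .inl ⟨k', rfl, by omega⟩
    · rw [hk, hc', adj_cycle_iff (by omega)]
      exact .inr (.inr ⟨c', rfl, by omega⟩)
    · rw [hc, hc', adj_right_iff]
      exact .inr ⟨c', rfl, by omega⟩
  · intro s t hst ht
    rcases hf s (by omega) with ⟨c, hc, h⟩ | ⟨k, hk, h⟩ | ⟨c, hc, h⟩ <;>
    rcases hf t (by omega) with ⟨c', hc', h'⟩ | ⟨k', hk', h'⟩ | ⟨c', hc', h'⟩ <;>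
    first | rw [hc] | rw [hk]
    all_goals
      first | rw [hc'] | rw [hk']
    all_goals
      simp only [ne_eq, Sum.inr.injEq, Sum.inl.injEq, Fin.ext_iff, reduceCtorEq,
        not_false_eq_true]
    all_goals omega

theorem path_cycle_left_iff (hn : 10 ≤ n) {i : Fin n} {c : Fin (n / 2 - 1)} {l : ℕ} :
    HasPathOfLength (cuttlefishGraph n) (.inl i) (.inr (.inl c)) l ↔
      l = c + 1 + i ∨ ((i : ℕ) ≠ 0 ∧ l + i = c + 1 + n) := by
  refine ⟨path_cycle_left (by omega), fun h => HasPathOfLength.symm ?_⟩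
  have hi := i.2
  have hc := c.2
  rcases h with rfl | ⟨h0, h⟩
  · obtain ⟨f, hf1, hf2, hf⟩ := left_forward_paths hn
    have := hf (n / 2 - 2 - c) (c + 1 + i) (by omega)
    rwa [hf1, show n / 2 - 2 - (c : ℕ) + (c + 1 + i) = n / 2 - 1 + i by omega, hf2] at this
  · obtain ⟨f, hf1, hf2, -, hf⟩ := left_backward_paths hn
    have := hf (n / 2 - 2 - c) l (by omega)
    rwa [hf1, show n / 2 - 2 - (c : ℕ) + l = n / 2 - 1 + (n - i) by omega, hf2 i h0] at this

theorem path_left_left_iff (hn : 10 ≤ n) {j c : Fin (n / 2 - 1)} {l : ℕ} :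
    HasPathOfLength (cuttlefishGraph n) (.inr (.inl j)) (.inr (.inl c)) l ↔
      l + j = c ∨ l + c = j := by
  refine ⟨path_left_left (by omega), ?_⟩
  have key : ∀ j c : Fin (n / 2 - 1), l + c = j →
      HasPathOfLength (cuttlefishGraph n) (.inr (.inl j)) (.inr (.inl c)) l := by
    intro j c h
    have hj := j.2
    obtain ⟨f, hf1, -, hf⟩ := left_forward_paths hn
    have := hf (n / 2 - 2 - j) l (by omega)
    rwa [hf1, show n / 2 - 2 - (j : ℕ) + l = n / 2 - 2 - c by omega, hf1] at this
  rintro (h | h)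
  · exact (key c j h).symm
  · exact key j c h

theorem path_left_right_iff (hn : 10 ≤ n) {j c : Fin (n / 2 - 1)} {l : ℕ} :
    HasPathOfLength (cuttlefishGraph n) (.inr (.inl j)) (.inr (.inr c)) l ↔
      l = j + c + 3 ∨ l = j + c + n + 1 := by
  refine ⟨path_left_right (by omega), ?_⟩
  have hj := j.2
  have hc := c.2
  rintro (rfl | rfl)
  -- The short path crosses from one arm to the other by the edge between indices 0 and 1; the long
  -- one goes round the rest of the cycle.
  · let f : ℕ → CuttlefishVertex n := fun t =>
      if h : t < j + 1 then .inr (.inl ⟨j - t, by omega⟩)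
      else if h : t = j + 1 then .inl ⟨0, by omega⟩
      else if h : t = j + 2 then .inl ⟨1, by omega⟩
      else .inr (.inr ⟨(t - (j + 3)) % (n / 2 - 1), Nat.mod_lt _ (by omega)⟩)
    have hf : ∀ t ≤ (j + c + 3 : ℕ),
        (∃ a : Fin (n / 2 - 1), f t = .inr (.inl a) ∧ (a + t : ℕ) = j) ∨
        (∃ k : Fin n, f t = .inl k ∧ (k : ℕ) ≤ 1 ∧ t = (j + 1 + k : ℕ)) ∨
        (∃ a : Fin (n / 2 - 1), f t = .inr (.inr a) ∧ t = (j + 3 + a : ℕ)) := by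
      intro t ht
      simp only [f]
      split_ifs with h1 h2 h3
      · exact .inl ⟨_, rfl, by dsimp only; omega⟩
      · exact .inr (.inl ⟨_, rfl, by simp, by simpa using h2⟩)
      · exact .inr (.inl ⟨_, rfl, by simp, by simpa using h3⟩)
      · refine .inr (.inr ⟨_, rfl, ?_⟩)
        dsimp only
        rw [Nat.mod_eq_of_lt (by omega)]
        omega
    have := hasPathOfLength_of_sequence (G := cuttlefishGraph n) (N := j + c + 3) f ?_ ?_ 0
      (j + c + 3) (by omega)
    · rcases hf 0 (by omega) with ⟨a, ha, ha'⟩ | ⟨a, ha, ha'⟩ | ⟨a, ha, ha'⟩ <;> try omega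
      rcases hf (0 + (j + c + 3)) (by omega) with ⟨b, hb, hb'⟩ | ⟨b, hb, hb'⟩ | ⟨b, hb, hb'⟩ <;>
        try omega
      have haj : a = j := Fin.ext (by omega)
      have hbc : b = c := Fin.ext (by omega)
      rwa [ha, hb, haj, hbc] at this
    · intro t ht
      rcases hf t (by omega) with ⟨a, ha, h⟩ | ⟨k, hk, h⟩ | ⟨a, ha, h⟩ <;>
      rcases hf (t + 1) (by omega) with ⟨a', ha', h'⟩ | ⟨k', hk', h'⟩ | ⟨a', ha', h'⟩ <;>
      try omega
      · rw [ha, ha', adj_left_iff]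
        exact .inr ⟨a', rfl, by omega⟩
      · rw [ha, hk', adj_left_iff]
        exact .inl ⟨k', rfl, by omega⟩
      · rw [hk, hk', adj_cycle_iff (by omega)]
        exact .inl ⟨k', rfl, by omega⟩
      · rw [hk, ha', adj_cycle_iff (by omega)]
        exact .inr (.inr ⟨a', rfl, by omega⟩)
      · rw [ha, ha', adj_right_iff]
        exact .inr ⟨a', rfl, by omega⟩
    · intro s t hst ht
      rcases hf s (by omega) with ⟨a, ha, h⟩ | ⟨k, ha, h⟩ | ⟨a, ha, h⟩ <;>
      rcases hf t (by omega) with ⟨a', ha', h'⟩ | ⟨k', ha', h'⟩ | ⟨a', ha', h'⟩ <;>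
      rw [ha, ha'] <;>
      simp only [ne_eq, Sum.inr.injEq, Sum.inl.injEq, Fin.ext_iff, reduceCtorEq,
        not_false_eq_true] <;>
      omega
  · obtain ⟨f, hf1, -, hf3, hf⟩ := left_backward_paths hn
    have := hf (n / 2 - 2 - j) (j + c + n + 1) (by omega)
    rwa [hf1, show n / 2 - 2 - (j : ℕ) + (j + c + n + 1) = n / 2 - 1 + n + c by omega, hf3] at this

theorem path_cycle_right_iff (hn : 10 ≤ n) {i : Fin n} {c : Fin (n / 2 - 1)} {l : ℕ} :
    HasPathOfLength (cuttlefishGraph n) (.inl i) (.inr (.inr c)) l ↔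
      (1 ≤ (i : ℕ) ∧ l = c + i) ∨ (2 ≤ (i : ℕ) ∧ l + i = c + 2 + n) ∨
        ((i : ℕ) = 0 ∧ (l = c + 2 ∨ l = c + n)) := by
  refine ⟨path_cycle_right (by omega), fun h => ?_⟩
  have hi := i.2
  rw [← cuttlefishReflect_involutive n (.inl i)]
  refine HasPathOfLength.reflect (y := .inr (.inl c)) (by omega) ?_
  rw [cuttlefishReflect, path_cycle_left_iff hn]
  dsimp only
  split_ifs <;> omega

end Existence

/-! ### A closed set of the right size -/

section UpperBound

variable {n : ℕ}

/-- Both appended paths together with `u_1, …, u_{⌈n/2⌉+1}`. -/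
def cuttlefishHalf (n : ℕ) : Finset (CuttlefishVertex n) :=
  Finset.disjSum {i : Fin n | (i : ℕ) ≤ (n + 1) / 2} Finset.univ

theorem inl_mem_cuttlefishHalf {i : Fin n} :
    (.inl i : CuttlefishVertex n) ∈ cuttlefishHalf n ↔ (i : ℕ) ≤ (n + 1) / 2 := by
  simp [cuttlefishHalf]

theorem inr_mem_cuttlefishHalf (c : Fin (n / 2 - 1) ⊕ Fin (n / 2 - 1)) :
    (.inr c : CuttlefishVertex n) ∈ cuttlefishHalf n := by
  simp [cuttlefishHalf]

theorem card_cuttlefishHalf (hn : 10 ≤ n) : (cuttlefishHalf n).card = n + (n / 2 - 1) := by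
  have h : ({i : Fin n | (i : ℕ) ≤ (n + 1) / 2} : Finset (Fin n)) =
      Finset.Iic ⟨(n + 1) / 2, by omega⟩ := by
    ext i
    simp [Fin.le_def]
  rw [cuttlefishHalf, Finset.card_disjSum, h, Fin.card_Iic, Finset.card_univ, Fintype.card_sum,
    Fintype.card_fin]
  dsimp only
  omega

/-- A target outside the set is a cycle vertex `k`. The Director usually answers with its mirror
image about the token, or about the foot of the token's arm; when that image is unsuitable, he
answers in the `v`-arm. -/
theorem isDirectorClosed_cuttlefishHalf (hn : 10 ≤ n) :
    IsDirectorClosed (cuttlefishGraph n) (cuttlefishHalf n) := by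
  rintro x hx l ⟨hl, y, hy⟩
  by_cases hyC : y ∈ cuttlefishHalf n
  · exact ⟨y, hyC, hy⟩
  rcases y with k | y
  swap
  · exact absurd (inr_mem_cuttlefishHalf y) hyC
  rw [inl_mem_cuttlefishHalf] at hyC
  have hk := k.2
  rcases x with i | j | j
  · rw [inl_mem_cuttlefishHalf] at hx
    rw [path_cycle_cycle_iff (by omega)] at hy
    by_cases h1 : (k : ℕ) ≤ 2 * i
    · refine ⟨.inl ⟨2 * i - k, by omega⟩, inl_mem_cuttlefishHalf.2 (by dsimp only; omega), ?_⟩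
      rw [path_cycle_cycle_iff (by omega)]
      dsimp only
      omega
    by_cases h2 : l ≤ i + (n / 2 - 1)
    · refine ⟨.inr (.inl ⟨l - i - 1, by omega⟩), inr_mem_cuttlefishHalf _, ?_⟩
      rw [path_cycle_left_iff hn]
      dsimp only
      omega
    · refine ⟨.inl ⟨n - k + 2 * i, by omega⟩, inl_mem_cuttlefishHalf.2 (by dsimp only; omega), ?_⟩
      rw [path_cycle_cycle_iff (by omega)]
      dsimp only
      omega
  · have hj := j.2
    have hy := hy.symm
    rw [path_cycle_left_iff hn] at hy
    refine ⟨.inl ⟨n - k, by omega⟩, inl_mem_cuttlefishHalf.2 (by dsimp only; omega),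
      HasPathOfLength.symm ?_⟩
    rw [path_cycle_left_iff hn]
    dsimp only
    omega
  · have hj := j.2
    have hy := hy.symm
    rw [path_cycle_right_iff hn] at hy
    by_cases h1 : n + 2 - k ≤ (n + 1) / 2
    · refine ⟨.inl ⟨n + 2 - k, by omega⟩, inl_mem_cuttlefishHalf.2 (by dsimp only; omega),
        HasPathOfLength.symm ?_⟩
      rw [path_cycle_right_iff hn]
      dsimp only
      omega
    -- Here `n` is even and `k = n / 2 + 1` is opposite to index 1, hence its own mirror image. The
    -- end of the other arm is at the same distance from the token.
    · refine ⟨.inr (.inl ⟨n / 2 - 2, by omega⟩), inr_mem_cuttlefishHalf _,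
        HasPathOfLength.symm ?_⟩
      rw [path_left_right_iff hn]
      dsimp only
      omega

/-- Every vertex lies in a closed set with `n + ⌊n/2⌋ - 1` vertices. -/
theorem exists_isDirectorClosed_mem (hn : 10 ≤ n) (v : CuttlefishVertex n) :
    ∃ C : Finset (CuttlefishVertex n), v ∈ C ∧ IsDirectorClosed (cuttlefishGraph n) C ∧
      C.card = n + (n / 2 - 1) := by
  by_cases hv : v ∈ cuttlefishHalf n
  · exact ⟨_, hv, isDirectorClosed_cuttlefishHalf hn, card_cuttlefishHalf hn⟩
  · refine ⟨_, ?_, (isDirectorClosed_cuttlefishHalf hn).map (cuttlefishReflectIso (by omega)),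
      (Finset.card_map _).trans (card_cuttlefishHalf hn)⟩
    rcases v with i | c
    · refine Finset.mem_map.2 ⟨cuttlefishReflect n (.inl i), ?_,
        cuttlefishReflect_involutive n (.inl i)⟩
      rw [inl_mem_cuttlefishHalf] at hv
      rw [cuttlefishReflect, inl_mem_cuttlefishHalf]
      dsimp only
      split_ifs <;> omega
    · exact absurd (inr_mem_cuttlefishHalf c) hv

end UpperBound

/-! ### Every nonempty closed set is large -/

section LowerBound

variable {n : ℕ}

/-- A set of naturals meeting each pair `{i, c - i}` with `i ∈ I` and containing a set `E` outside
these pairs has at least `|I| + |E|` elements. -/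
theorem card_add_card_le_of_pairs {T I E : Finset ℕ} (c : ℕ)
    (hI : ∀ i ∈ I, i ≤ c ∧ c < 2 * i ∧ (i ∈ T ∨ c - i ∈ T))
    (hE : ∀ e ∈ E, e ∈ T ∧ e ∉ I ∧ c - e ∉ I ∧ e ≤ c) : I.card + E.card ≤ T.card := by
  let g : ℕ → ℕ := fun i => if i ∈ T then i else c - i
  have hg : ∀ i ∈ I, g i ∈ T ∧ (g i = i ∨ g i = c - i) := by
    intro i hi
    have := hI i hi
    simp only [g]
    split_ifs with h
    · exact ⟨h, .inl rfl⟩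
    · exact ⟨by tauto, .inr rfl⟩
  have hinj : Set.InjOn g I := by
    intro i hi j hj hij
    have := hg i hi
    have := hg j hj
    have := hI i hi
    have := hI j hj
    omega
  have hdisj : Disjoint (I.image g) E := by
    rw [Finset.disjoint_left]
    intro x hx hxE
    obtain ⟨i, hi, rfl⟩ := Finset.mem_image.1 hx
    obtain ⟨h1, h2, h3, h4⟩ := hE _ hxE
    have := hI i hi
    rcases (hg i hi).2 with h | h
    · rw [h] at h2
      exact h2 hi
    · rw [h, show c - (c - i) = i by omega] at h3
      exact h3 hi
  rw [← Finset.card_image_of_injOn hinj, ← Finset.card_union_of_disjoint hdisj]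
  refine Finset.card_le_card (Finset.union_subset ?_ fun e he => (hE e he).1)
  intro x hx
  obtain ⟨i, hi, rfl⟩ := Finset.mem_image.1 hx
  exact (hg i hi).1

variable {C : Finset (CuttlefishVertex n)}

/-- The longest path from a vertex of the `w`-arm runs the long way round the cycle to the end of
the `v`-arm, and no other vertex is reached with that length. -/
theorem IsDirectorClosed.left_end_mem_of_right (hn : 10 ≤ n)
    (hC : IsDirectorClosed (cuttlefishGraph n) C) {j : Fin (n / 2 - 1)}
    (hj : (.inr (.inr j) : CuttlefishVertex n) ∈ C) :
    (.inr (.inl ⟨n / 2 - 2, by omega⟩) : CuttlefishVertex n) ∈ C := by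
  have hj' := j.2
  have h1 : HasPathOfLength (cuttlefishGraph n) (.inr (.inr j))
      (.inr (.inl ⟨n / 2 - 2, by omega⟩)) (j + (n / 2 - 2) + n + 1) := by
    refine HasPathOfLength.symm ((path_left_right_iff hn).2 ?_)
    dsimp only
    omega
  obtain ⟨y, hy, hp⟩ := hC _ hj _ ⟨by omega, _, h1⟩
  rcases y with k | c | c
  · have hk := k.2
    have := (path_cycle_right_iff hn).1 hp.symm
    omega
  · have hc := c.2
    have := (path_left_right_iff hn).1 hp.symm
    rwa [show c = ⟨n / 2 - 2, by omega⟩ from Fin.ext (by dsimp only; omega)] at hy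
  · have hc := c.2
    have := (path_left_left_iff hn).1 (hp.reflect (by omega))
    omega

theorem mem_map_cuttlefishReflectIso (hn : 3 ≤ n) {x : CuttlefishVertex n} :
    x ∈ C.map (cuttlefishReflectIso hn).toEquiv.toEmbedding ↔ cuttlefishReflect n x ∈ C := by
  rw [Finset.mem_map]
  constructor
  · rintro ⟨y, hy, rfl⟩
    exact (cuttlefishReflect_involutive n y).symm ▸ hy
  · exact fun h => ⟨_, h, cuttlefishReflect_involutive n x⟩

theorem IsDirectorClosed.right_end_mem_of_left (hn : 10 ≤ n)
    (hC : IsDirectorClosed (cuttlefishGraph n) C) {j : Fin (n / 2 - 1)}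
    (hj : (.inr (.inl j) : CuttlefishVertex n) ∈ C) :
    (.inr (.inr ⟨n / 2 - 2, by omega⟩) : CuttlefishVertex n) ∈ C := by
  have := (hC.map (cuttlefishReflectIso (by omega))).left_end_mem_of_right hn (j := j)
    ((mem_map_cuttlefishReflectIso (by omega)).2 hj)
  exact (mem_map_cuttlefishReflectIso (by omega)).1 this

/-- From a cycle vertex other than the one opposite to the edge `u_1 u_2`, the longest call forces
the token to the end of an appended path. -/
theorem IsDirectorClosed.end_mem_of_cycle (hn : 10 ≤ n)
    (hC : IsDirectorClosed (cuttlefishGraph n) C) {i : Fin n}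
    (hi : (.inl i : CuttlefishVertex n) ∈ C) (hin : 2 * (i : ℕ) ≠ n + 1) :
    (.inr (.inl ⟨n / 2 - 2, by omega⟩) : CuttlefishVertex n) ∈ C ∨
      (.inr (.inr ⟨n / 2 - 2, by omega⟩) : CuttlefishVertex n) ∈ C := by
  have hi' := i.2
  have h1 : ∃ l, n ≤ l ∧ IsValidCall (cuttlefishGraph n) (.inl i) l ∧
      (∀ c, HasPathOfLength (cuttlefishGraph n) (.inl i) (.inr (.inl c)) l →
        (c : ℕ) = n / 2 - 2) ∧
      (∀ c, HasPathOfLength (cuttlefishGraph n) (.inl i) (.inr (.inr c)) l →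
        (c : ℕ) = n / 2 - 2) := by
    simp only [path_cycle_left_iff hn, path_cycle_right_iff hn]
    -- In each case the call is the longest route to an arm's end. Its length is at least `n`, which
    -- excludes answers on the cycle; for `2 * i = n + 1` it would be only `n - 1`.
    by_cases h0 : (i : ℕ) = 0
    · refine ⟨n / 2 - 2 + n, by omega, ⟨by omega, .inr (.inr ⟨n / 2 - 2, by omega⟩), ?_⟩,
        fun c h => ?_, fun c h => ?_⟩
      · rw [path_cycle_right_iff hn]
        dsimp only
        omega
      all_goals
        have := c.2
        omega
    by_cases h1 : (i : ℕ) = 1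
    · refine ⟨n / 2 - 2 + n, by omega, ⟨by omega, .inr (.inl ⟨n / 2 - 2, by omega⟩), ?_⟩,
        fun c h => ?_, fun c h => ?_⟩
      · rw [path_cycle_left_iff hn]
        dsimp only
        omega
      all_goals
        have := c.2
        omega
    by_cases h2 : 2 * (i : ℕ) ≤ n
    · refine ⟨n / 2 + n - i, by omega, ⟨by omega, .inr (.inr ⟨n / 2 - 2, by omega⟩), ?_⟩,
        fun c h => ?_, fun c h => ?_⟩
      · rw [path_cycle_right_iff hn]
        dsimp only
        omega
      all_goals
        have := c.2
        omega
    · refine ⟨n / 2 - 1 + i, by omega, ⟨by omega, .inr (.inl ⟨n / 2 - 2, by omega⟩), ?_⟩,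
        fun c h => ?_, fun c h => ?_⟩
      · rw [path_cycle_left_iff hn]
        dsimp only
        omega
      all_goals
        have := c.2
        omega
  obtain ⟨l, hnl, hl, hL, hR⟩ := h1
  obtain ⟨y, hy, hp⟩ := hC _ hi l hl
  rcases y with k | c | c
  · have := (path_cycle_cycle_iff (by omega)).1 hp
    omega
  · left
    rwa [show c = ⟨n / 2 - 2, by omega⟩ from Fin.ext (hL c hp)] at hy
  · right
    rwa [show c = ⟨n / 2 - 2, by omega⟩ from Fin.ext (hR c hp)] at hy

/-- A call of `1` from a cycle vertex other than `u_1`, `u_2`. -/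
theorem IsDirectorClosed.exists_neighbour_mem (hn : 10 ≤ n)
    (hC : IsDirectorClosed (cuttlefishGraph n) C) {i : Fin n}
    (hi : (.inl i : CuttlefishVertex n) ∈ C) (h1 : 1 < (i : ℕ)) :
    ∃ k : Fin n, (.inl k : CuttlefishVertex n) ∈ C ∧
      ((k : ℕ) = i + 1 ∨ (i : ℕ) = k + 1 ∨ ((i : ℕ) + 1 = n ∧ (k : ℕ) = 0)) := by
  have hi' := i.2
  have hv : HasPathOfLength (cuttlefishGraph n) (.inl i) (.inl ⟨i - 1, by omega⟩) 1 := by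
    rw [path_cycle_cycle_iff (by omega)]
    dsimp only
    omega
  obtain ⟨y, hy, hp⟩ := hC _ hi 1 ⟨one_pos, _, hv⟩
  rcases y with k | c | c
  · have := k.2
    rw [path_cycle_cycle_iff (by omega)] at hp
    exact ⟨k, hy, by omega⟩
  · have := c.2
    rw [path_cycle_left_iff hn] at hp
    omega
  · have := c.2
    rw [path_cycle_right_iff hn] at hp
    omega

theorem IsDirectorClosed.ends_mem (hn : 10 ≤ n)
    (hC : IsDirectorClosed (cuttlefishGraph n) C) (hne : C.Nonempty) :
    (.inr (.inl ⟨n / 2 - 2, by omega⟩) : CuttlefishVertex n) ∈ C ∧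
      (.inr (.inr ⟨n / 2 - 2, by omega⟩) : CuttlefishVertex n) ∈ C := by
  suffices h : (.inr (.inl ⟨n / 2 - 2, by omega⟩) : CuttlefishVertex n) ∈ C ∨
      (.inr (.inr ⟨n / 2 - 2, by omega⟩) : CuttlefishVertex n) ∈ C from
    h.elim (fun h => ⟨h, hC.right_end_mem_of_left hn h⟩)
      (fun h => ⟨hC.left_end_mem_of_right hn h, h⟩)
  obtain ⟨x, hx⟩ := hne
  rcases x with i | j | j
  · by_cases hin : 2 * (i : ℕ) = n + 1
    -- The opposite vertex is the only exception, so a call of 1 moves the token to a vertex where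
    -- the long call works.
    · obtain ⟨k, hk, hki⟩ := hC.exists_neighbour_mem hn hx (by omega)
      exact hC.end_mem_of_cycle hn hk (by omega)
    · exact hC.end_mem_of_cycle hn hx hin
  · exact .inr (hC.right_end_mem_of_left hn hx)
  · exact .inl (hC.left_end_mem_of_right hn hx)

/-- From the end of an arm, a call shorter than the arm has only one answer. -/
theorem IsDirectorClosed.left_mem (hn : 10 ≤ n)
    (hC : IsDirectorClosed (cuttlefishGraph n) C) (hne : C.Nonempty) (c : Fin (n / 2 - 1)) :
    (.inr (.inl c) : CuttlefishVertex n) ∈ C := by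
  have hc := c.2
  obtain ⟨h, -⟩ := hC.ends_mem hn hne
  by_cases hce : (c : ℕ) = n / 2 - 2
  · rwa [show c = ⟨n / 2 - 2, by omega⟩ from Fin.ext hce]
  have hv : HasPathOfLength (cuttlefishGraph n) (.inr (.inl ⟨n / 2 - 2, by omega⟩))
      (.inr (.inl c)) (n / 2 - 2 - c) := by
    rw [path_left_left_iff hn]
    dsimp only
    omega
  obtain ⟨y, hy, hp⟩ := hC _ h _ ⟨by omega, _, hv⟩
  rcases y with k | d | d
  · have := k.2
    have := (path_cycle_left_iff hn).1 hp.symm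
    dsimp only at this
    omega
  · have := d.2
    rw [path_left_left_iff hn] at hp
    dsimp only at hp
    rwa [show c = d from Fin.ext (by omega)]
  · rw [path_left_right_iff hn] at hp
    dsimp only at hp
    omega

theorem IsDirectorClosed.zero_mem (hn : 10 ≤ n)
    (hC : IsDirectorClosed (cuttlefishGraph n) C) (hne : C.Nonempty) :
    (.inl ⟨0, by omega⟩ : CuttlefishVertex n) ∈ C := by
  obtain ⟨h, -⟩ := hC.ends_mem hn hne
  have hv : HasPathOfLength (cuttlefishGraph n) (.inr (.inl ⟨n / 2 - 2, by omega⟩))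
      (.inl ⟨0, by omega⟩) (n / 2 - 1) := by
    refine HasPathOfLength.symm ((path_cycle_left_iff hn).2 ?_)
    dsimp only
    omega
  obtain ⟨y, hy, hp⟩ := hC _ h _ ⟨by omega, _, hv⟩
  rcases y with k | d | d
  · have := k.2
    have := (path_cycle_left_iff hn).1 hp.symm
    dsimp only at this
    rwa [show k = ⟨0, by omega⟩ from Fin.ext (by dsimp only; omega)] at hy
  · have := d.2
    rw [path_left_left_iff hn] at hp
    dsimp only at hp
    omega
  · rw [path_left_right_iff hn] at hp
    dsimp only at hp
    omega

/-- A call from `v_m` forces one of two cycle vertices symmetric with respect to `u_1`. -/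
theorem IsDirectorClosed.pair_mem (hn : 10 ≤ n)
    (hC : IsDirectorClosed (cuttlefishGraph n) C) (hne : C.Nonempty) {i : ℕ}
    (h1 : n / 2 < i) (h2 : i + 2 ≤ n) :
    (.inl ⟨i, by omega⟩ : CuttlefishVertex n) ∈ C ∨
      (.inl ⟨n - i, by omega⟩ : CuttlefishVertex n) ∈ C := by
  obtain ⟨h, -⟩ := hC.ends_mem hn hne
  -- Since `i > n / 2`, the call is at least `2 * (n / 2)`, too long by one for the short route to
  -- the end of the other arm; it is too short for any long route into that arm.
  have hv : HasPathOfLength (cuttlefishGraph n) (.inr (.inl ⟨n / 2 - 2, by omega⟩))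
      (.inl ⟨i, by omega⟩) (n / 2 - 1 + i) := by
    refine HasPathOfLength.symm ((path_cycle_left_iff hn).2 ?_)
    dsimp only
    omega
  obtain ⟨y, hy, hp⟩ := hC _ h _ ⟨by omega, _, hv⟩
  rcases y with k | d | d
  · have := k.2
    have := (path_cycle_left_iff hn).1 hp.symm
    dsimp only at this
    by_cases hki : (k : ℕ) = i
    · left
      rwa [show k = ⟨i, by omega⟩ from Fin.ext hki] at hy
    · right
      rwa [show k = ⟨n - i, by omega⟩ from Fin.ext (by dsimp only; omega)] at hy
  · have := d.2
    rw [path_left_left_iff hn] at hp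
    dsimp only at hp
    omega
  · have := d.2
    rw [path_left_right_iff hn] at hp
    dsimp only at hp
    omega

/-- The indices of the cycle vertices in `C`. -/
def cycleIndices (C : Finset (CuttlefishVertex n)) : Finset ℕ :=
  ({i : Fin n | (.inl i : CuttlefishVertex n) ∈ C} : Finset (Fin n)).map Fin.valEmbedding

theorem mem_cycleIndices {i : ℕ} (hi : i < n) :
    i ∈ cycleIndices C ↔ (.inl ⟨i, hi⟩ : CuttlefishVertex n) ∈ C := by
  simp only [cycleIndices, Finset.mem_map, Finset.mem_filter, Finset.mem_univ, true_and,
    Fin.valEmbedding_apply]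
  constructor
  · rintro ⟨k, hk, rfl⟩
    exact hk
  · exact fun h => ⟨_, h, rfl⟩

theorem mem_cycleIndices_map {i : ℕ} (hn : 3 ≤ n) (h1 : 1 < i) (hi : i < n) :
    i ∈ cycleIndices (C.map (cuttlefishReflectIso hn).toEquiv.toEmbedding) ↔
      n + 1 - i ∈ cycleIndices C := by
  rw [mem_cycleIndices hi, mem_cycleIndices (by omega), mem_map_cuttlefishReflectIso hn,
    cuttlefishReflect]
  have h : (⟨if n = 1 then i else if i ≤ 1 then 1 - i else n + 1 - i, by
      split_ifs <;> omega⟩ : Fin n) = ⟨n + 1 - i, by omega⟩ := by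
    apply Fin.ext
    dsimp only
    split_ifs <;> omega
  exact h ▸ Iff.rfl

/-- Every nonempty closed set has at least `n + ⌊n/2⌋ - 1` vertices. -/
theorem IsDirectorClosed.le_card (hn : 10 ≤ n)
    (hC : IsDirectorClosed (cuttlefishGraph n) C) (hne : C.Nonempty) :
    n + (n / 2 - 1) ≤ C.card := by
  have hC' := hC.map (cuttlefishReflectIso (by omega))
  have hne' := hne.map (f := (cuttlefishReflectIso (n := n) (by omega)).toEquiv.toEmbedding)
  have h0 : 0 ∈ cycleIndices C := (mem_cycleIndices (by omega)).2 (hC.zero_mem hn hne)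
  have h1 : 1 ∈ cycleIndices C := by
    have := (mem_map_cuttlefishReflectIso (by omega)).1 (hC'.zero_mem hn hne')
    rw [mem_cycleIndices (by omega)]
    simpa [cuttlefishReflect, show n ≠ 1 by omega] using this
  have hA : ∀ i, n / 2 < i → i + 2 ≤ n → i ∈ cycleIndices C ∨ n - i ∈ cycleIndices C := by
    intro i hi hi'
    rw [mem_cycleIndices (by omega), mem_cycleIndices (by omega)]
    exact hC.pair_mem hn hne hi hi'
  have hB : ∀ i, n / 2 + 1 < i → i < n → i ∈ cycleIndices C ∨ n + 2 - i ∈ cycleIndices C := by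
    intro i hi hi'
    -- Reflecting the pair `{i - 1, n - (i - 1)}` gives `{n + 2 - i, i}`, symmetric about index 1.
    have := hC'.pair_mem hn hne' (i := i - 1) (by omega) (by omega)
    rw [← mem_cycleIndices (by omega), ← mem_cycleIndices (by omega),
      mem_cycleIndices_map (by omega) (by omega) (by omega),
      mem_cycleIndices_map (by omega) (by omega) (by omega),
      show n + 1 - (i - 1) = n + 2 - i by omega, show n + 1 - (n - (i - 1)) = i by omega] at this
    exact this.symm
  have hcard : (cycleIndices C).card + 2 * (n / 2 - 1) ≤ C.card := by
    have hsub : Finset.disjSum {i : Fin n | (.inl i : CuttlefishVertex n) ∈ C}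
        (Finset.univ : Finset (Fin (n / 2 - 1) ⊕ Fin (n / 2 - 1))) ⊆ C := by
      intro x hx
      rcases x with i | c | c
      · simpa using hx
      · exact hC.left_mem hn hne c
      · exact (mem_map_cuttlefishReflectIso (by omega)).1 (hC'.left_mem hn hne' c)
    have := Finset.card_le_card hsub
    rw [Finset.card_disjSum, Finset.card_univ, Fintype.card_sum, Fintype.card_fin] at this
    rw [cycleIndices, Finset.card_map]
    omega
  suffices n + 1 - n / 2 ≤ (cycleIndices C).card by omega
  -- The pairs `{i, n - i}` in use avoid 0, 1 and `n - 1`, so `n - 1` would be the missing vertex;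
  -- in the other family, that role is played by 2.
  by_cases hlast : n - 1 ∈ cycleIndices C
  · have h3 : ({0, 1, n - 1} : Finset ℕ).card = 3 := by
      rw [Finset.card_eq_three]
      exact ⟨0, 1, n - 1, by omega, by omega, by omega, rfl⟩
    have := card_add_card_le_of_pairs (T := cycleIndices C) (I := Finset.Icc (n / 2 + 1) (n - 2))
      (E := {0, 1, n - 1}) n ?_ ?_
    · rw [h3, Nat.card_Icc] at this
      omega
    · intro i hi
      rw [Finset.mem_Icc] at hi
      exact ⟨by omega, by omega, hA i (by omega) (by omega)⟩
    · simp only [Finset.mem_insert, Finset.mem_singleton, Finset.mem_Icc]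
      rintro e (rfl | rfl | rfl)
      · exact ⟨h0, by omega⟩
      · exact ⟨h1, by omega⟩
      · exact ⟨hlast, by omega⟩
  by_cases h2 : 2 ∈ cycleIndices C
  · have := card_add_card_le_of_pairs (T := cycleIndices C) (I := Finset.Icc (n / 2 + 2) (n - 1))
      (E := {0, 1, 2}) (n + 2) ?_ ?_
    · rw [show ({0, 1, 2} : Finset ℕ).card = 3 from rfl, Nat.card_Icc] at this
      omega
    · intro i hi
      rw [Finset.mem_Icc] at hi
      exact ⟨by omega, by omega, hB i (by omega) (by omega)⟩
    · simp only [Finset.mem_insert, Finset.mem_singleton, Finset.mem_Icc]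
      rintro e (rfl | rfl | rfl)
      · exact ⟨h0, by omega⟩
      · exact ⟨h1, by omega⟩
      · exact ⟨h2, by omega⟩
  -- With `n - 1` and 2 absent, their partners `n - 2` and 3 are present, and a call of 1 from 3
  -- forces 4. Then 4 and `n - 2` both lie in `C` and form one pair of sum `n + 2`, so that pair
  -- counts twice.
  have hn2 : n - 2 ∈ cycleIndices C := by
    refine (hA (n - 2) (by omega) (by omega)).resolve_right fun h => h2 ?_
    rwa [show n - (n - 2) = 2 by omega] at h
  have h3 : 3 ∈ cycleIndices C := by
    have := (hB (n - 1) (by omega) (by omega)).resolve_left hlast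
    rwa [show n + 2 - (n - 1) = 3 by omega] at this
  have h4 : 4 ∈ cycleIndices C := by
    rw [mem_cycleIndices (by omega)] at h3
    obtain ⟨k, hk, hk'⟩ := hC.exists_neighbour_mem hn h3 (by simp)
    rw [← mem_cycleIndices k.2] at hk
    dsimp only at hk'
    rcases hk' with h | h | h
    · rwa [h] at hk
    · exact absurd ((show (k : ℕ) = 2 by omega) ▸ hk) h2
    · omega
  have hE : ({0, 1, 4, n - 2} : Finset ℕ).card = 4 := by
    rw [Finset.card_insert_of_notMem, Finset.card_insert_of_notMem, Finset.card_pair (by omega)] <;>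
      simp only [Finset.mem_insert, Finset.mem_singleton] <;> omega
  have := card_add_card_le_of_pairs (T := cycleIndices C)
    (I := (Finset.Icc (n / 2 + 2) (n - 1)).erase (n - 2)) (E := {0, 1, 4, n - 2}) (n + 2) ?_ ?_
  · rw [hE, Finset.card_erase_of_mem (Finset.mem_Icc.2 (by omega)), Nat.card_Icc] at this
    omega
  · intro i hi
    rw [Finset.mem_erase, Finset.mem_Icc] at hi
    exact ⟨by omega, by omega, hB i (by omega) (by omega)⟩
  · simp only [Finset.mem_insert, Finset.mem_singleton, Finset.mem_erase, Finset.mem_Icc]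
    rintro e (rfl | rfl | rfl | rfl)
    · exact ⟨h0, by omega⟩
    · exact ⟨h1, by omega⟩
    · exact ⟨h4, by omega⟩
    · exact ⟨hn2, by omega⟩

end LowerBound

theorem mainTheorem2 (n : ℕ) (hn : 10 ≤ n) (v : CuttlefishVertex n) :
    (Odd n → pathExplorerNumber (cuttlefishGraph n) v = 3 * (n / 2)) ∧
    (Even n → pathExplorerNumber (cuttlefishGraph n) v = 3 * n / 2 - 1) := by
  obtain ⟨C, hv, hC, hcard⟩ := exists_isDirectorClosed_mem hn v
  have h : pathExplorerNumber (cuttlefishGraph n) v = n + (n / 2 - 1) :=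
    pathExplorerNumber_eq (fun D hne hD => hD.le_card hn hne) hv hC hcard.le
  rw [h]
  constructor
  · rintro ⟨r, rfl⟩
    omega
  · rintro ⟨r, rfl⟩
    omega
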